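/- Let $U=\,]0,+\infty[$, let $\mathcal D=C_c^\infty(U)$ be the space of real test functions on $U$ and $\mathcal D'$ the space of distributions on $U$. Let $\xi=(\xi_1,\dots,\xi_m)$ be an $m$-dimensional white noise on a probability space: the $\xi_\ell$ are independent random distributions on $U$ (random elements of $\mathcal D'$ with the Borel $\sigma$-field of the weak-$\star$ topology) such that each $\langle\xi_\ell,\phi\rangle$ is centred Gaussian and $\mathrm E[\langle\xi_\ell,\phi\rangle\langle\xi_\ell,\psi\rangle]=\int_0^\infty\phi(s)\psi(s)\,ds$ for $\phi,\psi\in\mathcal D$. Let $A,B\in\mathbb R^{n\times n}$, let $f\in(\mathcal D')^n$ and $\Lambda\in\mathbb R^{n\times m}$, and consider the stochastic differential-algebraic equation $$A\dot x+Bx=f+\Lambda\xi. \qquad (1)$$ A solution of (1) is an $n$-dimensional random distribution $x$ such that, for almost all $\omega$, $A\langle\dot x(\omega),\phi\rangle+B\langle x(\omega),\phi\rangle=\langle f,\phi\rangle+\Lambda\langle\xi(\omega),\phi\rangle$ for all $\phi\in\mathcal D$, where $\langle\dot x,\phi\rangle=-\langle x,\dot\phi\rangle$. Assume that the pencil $(A,B)$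 is regular, i.e. $\det(\lambda A+B)\neq0$ for some $\lambda\in\mathbb R$, and that $\Lambda$ has full row rank, $\operatorname{rank}\Lambda=n$. Let $P,Q\in\mathbb R^{n\times n}$ be nonsingular matrices reducing the pencil to Kronecker canonical form, $$PAQ=\begin{pmatrix}I_d&0\\0&N\end{pmatrix},\qquad PBQ=\begin{pmatrix}J&0\\0&I_q\end{pmatrix},\qquad d+q=n,$$ where $J\in\mathbb R^{d\times d}$ (in Jordan form, or any real matrix) and $N$ is block diagonal, each block having ones just above the diagonal and zeros elsewhere. Let $r$ be the nilpotency index of $N$ and assume $r\le4$. Let $\phi_0\in\mathcal D$ with $\int_0^\infty\phi_0=1$, let $u^0\in\mathbb R^d$, and let $x$ be a solution of (1) with $\langle Q^{-1}x,\phi_0\rangle_i=u^0_i$ almost surely for $i=1,\dots,d$. Then, for every $\phi\in\mathcal D$ with $\phi\neq0$ and, if $d\ge1$, $\phi\notin\mathbb R\phi_0$, the law of the random vector $\langle x,\phi\rangle=(\langle x_1,\phi\rangle,\dots,\langle x_n,\phi\rangle)$ is absolutely continuous with respect to Lebesgue measure on $\mathbb R^n$. -/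

import Mathlib

open MeasureTheory ProbabilityTheory
open scoped Distributions LineDeriv Matrix

noncomputable section

namespace SDAE

/-- The open half-line `]0, +∞[`, the base set of all distributions. -/
def halfLine : TopologicalSpace.Opens ℝ := ⟨Set.Ioi 0, isOpen_Ioi⟩

/-- Test functions: smooth real functions with compact support contained in `]0, +∞[`. -/
abbrev Test : Type := 𝓓(halfLine, ℝ)

/-- Real distributions on `]0, +∞[`. -/
abbrev Distr : Type := 𝓓'(halfLine, ℝ)

/-- The weak-star topology on the space of distributions: the coarsest topology that makes
`T ↦ ⟨T, φ⟩` continuous for every test function `φ`. -/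
abbrev weakStarTopology : TopologicalSpace Distr :=
  TopologicalSpace.induced (fun (T : Distr) (φ : Test) => T φ) inferInstance

/-- Distributions carry the Borel σ-field of the weak-star topology. -/
instance instMeasurableSpaceDistr : MeasurableSpace Distr := @borel Distr weakStarTopology

/-! ### White noise -/

/-- A one-dimensional white noise: a random distribution `ξ` on `]0, +∞[` such that every `⟨ξ, φ⟩`
is a centred Gaussian variable, with correlation functional
`E[⟨ξ, φ⟩ ⟨ξ, ψ⟩] = ∫₀^∞ φ(s) ψ(s) ds`. -/
structure IsWhiteNoise {Ω : Type*} [MeasurableSpace Ω] (μ : Measure Ω) (ξ : Ω → Distr) :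
    Prop where
  measurable : Measurable ξ
  gaussian : ∀ φ : Test, ∃ v : NNReal, μ.map (fun ω => ξ ω φ) = gaussianReal 0 v
  correlation : ∀ φ ψ : Test,
    ∫ ω, ξ ω φ * ξ ω ψ ∂μ = ∫ s in Set.Ioi (0 : ℝ), φ s * ψ s

/-- An `m`-dimensional white noise: `m` independent one-dimensional white noises. -/
structure IsWhiteNoiseVec {Ω : Type*} [MeasurableSpace Ω] (μ : Measure Ω) {m : ℕ}
    (ξ : Ω → Fin m → Distr) : Prop where
  component : ∀ l, IsWhiteNoise μ (fun ω => ξ ω l)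
  indep : iIndepFun (fun l ω => ξ ω l) μ

/-! ### Differential-algebraic equations -/

/-- `x` solves `A ẋ + B x = g` in the sense of distributions on `]0, +∞[`. -/
def SolvesDAE {n : ℕ} (A B : Matrix (Fin n) (Fin n) ℝ) (g x : Fin n → Distr) : Prop :=
  ∀ φ : Test, A *ᵥ (fun j => (∂_{(1 : ℝ)} (x j) : Distr) φ) + B *ᵥ (fun j => x j φ) =
    fun i => g i φ

/-- `x` is a solution of the stochastic equation `A ẋ + B x = f + Λ ξ`: an `n`-dimensional random
distribution almost all of whose realisations solve the deterministic equation. -/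
structure IsSolution {Ω : Type*} [MeasurableSpace Ω] (μ : Measure Ω) {n m : ℕ}
    (A B : Matrix (Fin n) (Fin n) ℝ) (f : Fin n → Distr) (Λ : Matrix (Fin n) (Fin m) ℝ)
    (ξ : Ω → Fin m → Distr) (x : Ω → Fin n → Distr) : Prop where
  measurable : Measurable x
  solves : ∀ᵐ ω ∂μ, SolvesDAE A B (fun i => f i + ∑ l, Λ i l • ξ ω l) (x ω)

/-- `(A, B)` is a regular matrix pencil. -/
def IsRegularPencil {n : ℕ} (A B : Matrix (Fin n) (Fin n) ℝ) : Prop :=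
  ∃ c : ℝ, (c • A + B).det ≠ 0

/-! ### Kronecker canonical form -/

/-- The `k × k` nilpotent Jordan block, with ones just above the diagonal and zeros elsewhere. -/
def nilBlock (k : ℕ) : Matrix (Fin k) (Fin k) ℝ :=
  Matrix.of fun i j => if (i : ℕ) + 1 = (j : ℕ) then 1 else 0

/-- A reduction of the pencil `(A, B)` to Kronecker canonical form:
`P A Q = diag(I_d, N)` and `P B Q = diag(J, I_q)` with `P`, `Q` nonsingular, `d + q = n` and
`N = blockdiag(N₁, …, N_s)` where each `N_i` is a nilpotent Jordan block of positive size.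
The `d × d` matrix `J` is allowed to be any real matrix (in particular a Jordan form). -/
structure KroneckerForm {n : ℕ} (A B : Matrix (Fin n) (Fin n) ℝ) where
  /-- the number of differential variables -/
  d : ℕ
  /-- the number of algebraic variables -/
  q : ℕ
  dim_eq : d + q = n
  /-- the number of nilpotent blocks -/
  s : ℕ
  /-- the sizes of the nilpotent blocks -/
  size : Fin s → ℕ
  size_pos : ∀ i, 0 < size i
  sum_size : ∑ i, size i = q
  P : Matrix (Fin n) (Fin n) ℝ
  Q : Matrix (Fin n) (Fin n) ℝ
  isUnit_P : IsUnit P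
  isUnit_Q : IsUnit Q
  J : Matrix (Fin d) (Fin d) ℝ
  N : Matrix (Fin q) (Fin q) ℝ
  N_eq : N = Matrix.reindex (finSigmaFinEquiv.trans (finCongr sum_size))
    (finSigmaFinEquiv.trans (finCongr sum_size)) (Matrix.blockDiagonal' fun i => nilBlock (size i))
  PAQ_eq : P * A * Q = Matrix.reindex (finSumFinEquiv.trans (finCongr dim_eq))
    (finSumFinEquiv.trans (finCongr dim_eq)) (Matrix.fromBlocks 1 0 0 N)
  PBQ_eq : P * B * Q = Matrix.reindex (finSumFinEquiv.trans (finCongr dim_eq))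
    (finSumFinEquiv.trans (finCongr dim_eq)) (Matrix.fromBlocks J 0 0 1)

/-- The index of the equation: the nilpotency index of the matrix `N`. -/
def KroneckerForm.index {n : ℕ} {A B : Matrix (Fin n) (Fin n) ℝ} (K : KroneckerForm A B) : ℕ :=
  nilpotencyClass K.N

/-- The initial condition `⟨Q⁻¹ x, φ₀⟩_i = u⁰_i`, `i = 1, …, d`, for one realisation `x`. -/
def KroneckerForm.InitialCondition {n : ℕ} {A B : Matrix (Fin n) (Fin n) ℝ}
    (K : KroneckerForm A B) (φ₀ : Test) (u₀ : Fin K.d → ℝ) (x : Fin n → Distr) : Prop :=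
  ∀ i : Fin K.d,
    (K.Q⁻¹ *ᵥ (fun j => x j φ₀)) (finCongr K.dim_eq (Fin.castAdd K.q i)) = u₀ i

end SDAE

end

/-! Duality turns (1) into an identity for row vectors of test functions. With `L Θ = Θ B - Θ' A`
(`pencilOp`), almost surely `⟨x, L Θ⟩ = ⟨f, Θ⟩ + ⟨ξ, Θ Λ⟩`, so `x` is known modulo noise on the
range of `L`.

In Kronecker coordinates the algebraic part of `L` is onto. The differential part misses at most the
`d` conditions `∫ exp(-s Jᵀ) g(s) ds = 0` (`KroneckerForm.exists_obstruction`). The `d`-dimensional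
family of rows `φ₀ β Q₁`, on which the initial condition fixes `x`, must therefore either complement
the range of `L` or meet it in some `β ≠ 0`. In the latter case a noise integral `⟨ξ, Θ Λ⟩` would be
almost surely constant; its variance and the rank of `Λ` give `Θ = 0`, hence `β = 0`, a
contradiction.

Otherwise `e_i φ = L Θ_i + φ₀ β_i Q₁`, and `⟨x_i, φ⟩` is a constant plus `⟨ξ, Θ_i Λ⟩`. A linear
relation among the `Θ_i` would make `φ` vanish or be a multiple of `φ₀`, so the Gaussian vector is
nondegenerate (`IsWhiteNoiseVec.absolutelyContinuous_pairing`). -/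

namespace SDAE

/-! ### Algebra of the adjoint pencil on row vectors. -/

section RowAction

variable {M ι κ τ : Type*} [AddCommGroup M] [Module ℝ M] [Fintype ι]

/-- Multiplication of a row vector with entries in a module by a real matrix. -/
def rowMul (A : Matrix ι κ ℝ) : (ι → M) →ₗ[ℝ] (κ → M) where
  toFun Θ j := ∑ i, A i j • Θ i
  map_add' Θ Θ' := by ext j; simp [Finset.sum_add_distrib]
  map_smul' c Θ := by
    ext j
    simp [Finset.smul_sum, smul_comm c]

lemma rowMul_apply (A : Matrix ι κ ℝ) (Θ : ι → M) (j : κ) :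
    rowMul A Θ j = ∑ i, A i j • Θ i := rfl

lemma rowMul_mul [Fintype κ] (A : Matrix ι κ ℝ) (B : Matrix κ τ ℝ) (Θ : ι → M) :
    rowMul (A * B) Θ = rowMul B (rowMul A Θ) := by
  ext j
  simp only [rowMul_apply, Matrix.mul_apply, Finset.sum_smul, Finset.smul_sum, smul_smul]
  rw [Finset.sum_comm]
  simp_rw [mul_comm]

lemma rowMul_one [DecidableEq ι] (Θ : ι → M) : rowMul (1 : Matrix ι ι ℝ) Θ = Θ := by
  ext j
  simp [rowMul_apply, Matrix.one_apply, ite_smul]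

lemma rowMul_injective_of_isUnit [DecidableEq ι] {Q : Matrix ι ι ℝ} (hQ : IsUnit Q) :
    Function.Injective (rowMul Q : (ι → M) →ₗ[ℝ] (ι → M)) := by
  intro Θ Θ' h
  have hdet := (Matrix.isUnit_iff_isUnit_det Q).1 hQ
  rw [← rowMul_one Θ, ← rowMul_one Θ', ← Matrix.mul_nonsing_inv Q hdet, rowMul_mul, rowMul_mul, h]

/-- The formal adjoint of `x ↦ A ẋ + B x`, acting on row vectors; `D` is the derivation. -/
def pencilOp (D : M →ₗ[ℝ] M) (A B : Matrix ι κ ℝ) : (ι → M) →ₗ[ℝ] (κ → M) :=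
  rowMul B - rowMul A ∘ₗ D.compLeft ι

lemma pencilOp_apply (D : M →ₗ[ℝ] M) (A B : Matrix ι κ ℝ) (Θ : ι → M) (j : κ) :
    pencilOp D A B Θ j = ∑ i, B i j • Θ i - ∑ i, A i j • D (Θ i) := rfl

lemma compLeft_rowMul (D : M →ₗ[ℝ] M) (A : Matrix ι κ ℝ) (Θ : ι → M) :
    D.compLeft κ (rowMul A Θ) = rowMul A (D.compLeft ι Θ) := by
  ext j
  simp [rowMul_apply]

lemma pencilOp_mul_mul (D : M →ₗ[ℝ] M) (A B P Q : Matrix ι ι ℝ) (Θ : ι → M) :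
    pencilOp D (P * A * Q) (P * B * Q) Θ = rowMul Q (pencilOp D A B (rowMul P Θ)) := by
  simp only [pencilOp, LinearMap.sub_apply, LinearMap.comp_apply, rowMul_mul, map_sub,
    compLeft_rowMul]

/-- The operator is `1 - N D`, where the actions of `N` and `D` commute. Thus `N D` is nilpotent and
a finite Neumann series inverts the operator. -/
lemma pencilOp_nilpotent_surjective [DecidableEq ι] (D : M →ₗ[ℝ] M) {N : Matrix ι ι ℝ}
    (hN : IsNilpotent N) : Function.Surjective (pencilOp D N 1) := by
  obtain ⟨k, hk⟩ := hN
  have key : ∀ (p : ℕ) (Θ : ι → M), ((rowMul N ∘ₗ D.compLeft ι : Module.End ℝ (ι → M)) ^ p) Θ =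
      rowMul (N ^ p) (((D.compLeft ι : Module.End ℝ (ι → M)) ^ p) Θ) := by
    intro p
    induction p with
    | zero => intro Θ; simp [rowMul_one]
    | succ p ih =>
      intro Θ
      rw [pow_succ', Module.End.mul_apply, ih, pow_succ, rowMul_mul, pow_succ',
        Module.End.mul_apply, LinearMap.comp_apply, compLeft_rowMul]
  have hnil : IsNilpotent (rowMul N ∘ₗ D.compLeft ι : Module.End ℝ (ι → M)) := by
    refine ⟨k, ?_⟩
    refine LinearMap.ext fun Θ => ?_
    rw [key, hk]
    ext j
    simp [rowMul_apply]
  have hunit := hnil.isUnit_one_sub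
  have heq : (pencilOp D N 1 : Module.End ℝ (ι → M)) = 1 - rowMul N ∘ₗ D.compLeft ι := by
    refine LinearMap.ext fun Θ => ?_
    simp [pencilOp, rowMul_one]
  rw [heq]
  exact ((Module.End.isUnit_iff _).1 hunit).2

end RowAction

lemma nilBlock_pow_apply_ne_zero (k p : ℕ) (i j : Fin k) (h : (nilBlock k ^ p) i j ≠ 0) :
    (i : ℕ) + p ≤ j := by
  induction p generalizing j with
  | zero =>
    rw [pow_zero, Matrix.one_apply] at h
    split_ifs at h with hij
    · simp [hij]
    · simp at h
  | succ p ih =>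
    rw [pow_succ, Matrix.mul_apply] at h
    obtain ⟨l, -, hl⟩ := Finset.exists_ne_zero_of_sum_ne_zero h
    have h1 := ih l (left_ne_zero_of_mul hl)
    have h2 := right_ne_zero_of_mul hl
    simp only [nilBlock, Matrix.of_apply] at h2
    split_ifs at h2 with h3
    · omega
    · simp at h2

lemma nilBlock_pow_eq_zero {k p : ℕ} (h : k ≤ p) : nilBlock k ^ p = 0 := by
  ext i j
  by_contra hne
  have := nilBlock_pow_apply_ne_zero k p i j hne
  omega

lemma KroneckerForm.isNilpotent_N {n : ℕ} {A B : Matrix (Fin n) (Fin n) ℝ}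
    (K : KroneckerForm A B) : IsNilpotent K.N := by
  -- No block is larger than `q`, so this exponent kills every block at once.
  refine ⟨K.q, ?_⟩
  rw [K.N_eq, ← Matrix.coe_reindexAlgEquiv ℝ ℝ, ← map_pow, ← Matrix.blockDiagonal'_pow]
  have : (fun i => nilBlock (K.size i)) ^ K.q = 0 := by
    ext1 i
    refine nilBlock_pow_eq_zero ?_
    rw [← K.sum_size]
    exact Finset.single_le_sum (f := K.size) (fun _ _ => Nat.zero_le _) (Finset.mem_univ i)
  rw [this, Matrix.blockDiagonal'_zero, map_zero]

/-- Either some nonzero element of the source of `b` is mapped into the range of `L`,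
or `b` is onto modulo the range of `L`. -/
lemma exists_mem_range_or_forall_sub_mem_range {V W : Type*} [AddCommGroup V] [Module ℝ V]
    [AddCommGroup W] [Module ℝ W] {d : ℕ} (L : W →ₗ[ℝ] V) (ρ : V →ₗ[ℝ] (Fin d → ℝ))
    (hρ : LinearMap.ker ρ ≤ LinearMap.range L) (b : (Fin d → ℝ) →ₗ[ℝ] V) :
    (∃ β, β ≠ 0 ∧ b β ∈ LinearMap.range L) ∨ ∀ v, ∃ β, v - b β ∈ LinearMap.range L := by
  -- `ρ ∘ₗ b` is an endomorphism of `ℝ^d`, for which injective and surjective coincide.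
  by_cases hinj : Function.Injective (ρ ∘ₗ b)
  · right
    intro v
    obtain ⟨β, hβ⟩ := (LinearMap.injective_iff_surjective.1 hinj) (ρ v)
    refine ⟨β, hρ ?_⟩
    rw [LinearMap.mem_ker, map_sub, ← hβ, LinearMap.comp_apply, sub_self]
  · left
    rw [← LinearMap.ker_eq_bot, Submodule.eq_bot_iff] at hinj
    push Not at hinj
    obtain ⟨β, hβ, hne⟩ := hinj
    exact ⟨β, hne, hρ hβ⟩

/-! ### Solving the adjoint equation in test functions. -/

/-- Differentiation of test functions. -/
noncomputable def testDeriv : Test →ₗ[ℝ] Test :=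
  (TestFunction.lineDerivCLM ℝ (1 : ℝ) : Test →L[ℝ] Test).toLinearMap

lemma testDeriv_apply (φ : Test) (t : ℝ) : testDeriv φ t = deriv φ t := by
  change (TestFunction.lineDerivCLM ℝ (1 : ℝ) φ : Test) t = _
  rw [TestFunction.lineDerivCLM_apply_of_le (by simp), lineDeriv]
  simp [deriv_comp_const_add]

lemma sum_smul_test_apply {ι : Type*} [Fintype ι] (c : ι → ℝ) (g : ι → Test) (t : ℝ) :
    (∑ i, c i • g i) t = ∑ i, c i * g i t := by
  let ev : Test →ₗ[ℝ] ℝ := ⟨⟨fun φ => φ t, fun _ _ => rfl⟩, fun _ _ => rfl⟩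
  change ev (∑ i, c i • g i) = _
  rw [map_sum]
  rfl

lemma Distr.lineDeriv_apply (T : Distr) (φ : Test) :
    (∂_{(1 : ℝ)} T : Distr) φ = -T (testDeriv φ) := rfl

section ODE
open NormedSpace

variable {E : Type*} [NormedAddCommGroup E] [NormedSpace ℝ E] [CompleteSpace E]

lemma contDiff_exp_smul {𝔸 : Type*} [NormedRing 𝔸] [NormedAlgebra ℝ 𝔸] [CompleteSpace 𝔸] (x : 𝔸) :
    ContDiff ℝ (⊤ : ℕ∞) (fun t : ℝ => exp (t • x)) := by
  have h : ContDiff ℝ (⊤ : ℕ∞) (exp : 𝔸 → 𝔸) := by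
    rw [contDiff_iff_contDiffAt]
    exact fun y => (exp_analytic (𝕂 := ℝ) y).contDiffAt
  exact h.comp (contDiff_id.smul contDiff_const)

lemma contDiff_intervalIntegral {h : ℝ → E} (hh : ContDiff ℝ (⊤ : ℕ∞) h) :
    ContDiff ℝ (⊤ : ℕ∞) (fun t => ∫ s in (0 : ℝ)..t, h s) := by
  have hd : ∀ t, HasDerivAt (fun t => ∫ s in (0 : ℝ)..t, h s) (h t) t := fun t =>
    intervalIntegral.integral_hasDerivAt_right (hh.continuous.intervalIntegrable _ _)
      hh.continuous.stronglyMeasurable.stronglyMeasurableAtFilter hh.continuous.continuousAt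
  refine contDiff_infty_iff_deriv.2 ⟨fun t => (hd t).differentiableAt, ?_⟩
  rwa [funext fun t => (hd t).deriv]

/-- A smooth compactly supported solution of `T y - y' = G`, when the obstruction
`∫ exp(-sT) G(s) ds` vanishes. -/
lemma exists_compactSupport_solution (T : E →L[ℝ] E) {G : ℝ → E} (hG : ContDiff ℝ (⊤ : ℕ∞) G)
    {a b : ℝ} (ha : 0 < a) (hsupp : ∀ s, s ∉ Set.Icc a b → G s = 0)
    (hint : ∫ s, exp (s • (-T)) (G s) = 0) :
    ∃ y : ℝ → E, ContDiff ℝ (⊤ : ℕ∞) y ∧ (∀ s, s ∉ Set.Icc a b → y s = 0) ∧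
      ∀ t, T (y t) - deriv y t = G t := by
  set h : ℝ → E := fun s => exp (s • (-T)) (G s) with hh
  have hsm : ContDiff ℝ (⊤ : ℕ∞) h := (contDiff_exp_smul (-T)).clm_apply hG
  have hh0 : ∀ s, s ∉ Set.Icc a b → h s = 0 := fun s hs => by simp [hh, hsupp s hs]
  set I : ℝ → E := fun t => ∫ s in (0 : ℝ)..t, h s with hI
  have hIsm : ContDiff ℝ (⊤ : ℕ∞) I := contDiff_intervalIntegral hsm
  have hId : ∀ t, HasDerivAt I (h t) t := fun t =>
    intervalIntegral.integral_hasDerivAt_right (hsm.continuous.intervalIntegrable _ _)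
      hsm.continuous.stronglyMeasurable.stronglyMeasurableAtFilter hsm.continuous.continuousAt
  -- To the left of `a` the integrand vanishes; to the right of `b` the primitive is the full
  -- integral, which is zero by `hint`.
  have hI0 : ∀ s, s ∉ Set.Icc a b → I s = 0 := by
    intro t ht
    rcases lt_or_ge t a with hta | hta
    · refine intervalIntegral.integral_zero_ae (Filter.Eventually.of_forall fun s hs => hh0 s ?_)
      intro hs'
      have : s ≤ max 0 t := hs.2
      have : max 0 t < a := max_lt ha hta
      linarith [hs'.1]
    · have htb : b < t := by
        by_contra hcon
        exact ht ⟨hta, not_lt.1 hcon⟩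
      rw [hI, ← hint]
      refine intervalIntegral.integral_eq_integral_of_support_subset fun s hs => ?_
      have : s ∈ Set.Icc a b := by
        by_contra hcon
        exact hs (hh0 s hcon)
      exact ⟨lt_of_lt_of_le ha this.1, this.2.trans htb.le⟩
  -- Variation of constants: `y(t) = -exp(tT) ∫₀ᵗ exp(-sT) G(s) ds`.
  refine ⟨fun t => -(exp (t • T) (I t)), ((contDiff_exp_smul T).clm_apply hIsm).neg,
    fun s hs => by simp [hI0 s hs], fun t => ?_⟩
  have hd := ((hasDerivAt_exp_smul_const' (𝕂 := ℝ) T t).clm_apply (hId t)).neg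
  have hinv : exp (t • T) (h t) = G t := by
    have h1 : exp (t • T) * exp (t • (-T)) = 1 := by
      let : NormedAlgebra ℚ (E →L[ℝ] E) := NormedAlgebra.restrictScalars ℚ ℝ _
      rw [smul_neg, ← exp_add_of_commute ((Commute.refl _).neg_right), add_neg_cancel, exp_zero]
    have := congrArg (fun S : E →L[ℝ] E => S (G t)) h1
    simpa [hh] using this
  have hd' : deriv (fun t => -(exp (t • T) (I t))) t = _ := hd.deriv
  rw [hd', hinv]
  simp

end ODE

lemma exists_Icc_of_test {ι : Type*} [Finite ι] (g : ι → Test) :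
    ∃ a b : ℝ, 0 < a ∧ a ≤ b ∧ ∀ s, s ∉ Set.Icc a b → ∀ i, g i s = 0 := by
  have hK : IsCompact (⋃ i, tsupport (g i)) := isCompact_iUnion fun i => (g i).hasCompactSupport
  have hpos : ∀ s ∈ ⋃ i, tsupport (g i), 0 < s := by
    intro s hs
    obtain ⟨i, hi⟩ := Set.mem_iUnion.1 hs
    exact (g i).tsupport_subset hi
  have hzero : ∀ s, s ∉ ⋃ i, tsupport (g i) → ∀ i, g i s = 0 := fun s hs i =>
    image_eq_zero_of_notMem_tsupport fun hi => hs (Set.mem_iUnion.2 ⟨i, hi⟩)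
  rcases (⋃ i, tsupport (g i)).eq_empty_or_nonempty with hemp | hne
  · exact ⟨1, 1, one_pos, le_rfl, fun s _ => hzero s (by simp [hemp])⟩
  · obtain ⟨a, ha, hamin⟩ := hK.exists_isLeast hne
    obtain ⟨b, hb, hbmax⟩ := hK.exists_isGreatest hne
    exact ⟨a, b, hpos a ha, hamin hb, fun s hs => hzero s fun hs' => hs ⟨hamin hs', hbmax hs'⟩⟩

/-- The obstruction to solving `y J - y' = g` in test functions. -/
noncomputable def odeObstruction {d : ℕ} (J : Matrix (Fin d) (Fin d) ℝ) :
    (Fin d → Test) →ₗ[ℝ] (Fin d → ℝ) where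
  toFun g := ∫ s, NormedSpace.exp (s • (-(Matrix.toLin' Jᵀ).toContinuousLinearMap)) (fun i => g i s)
  map_add' g g' := by
    have hint : ∀ g : Fin d → Test, Integrable fun s : ℝ =>
        NormedSpace.exp (s • (-(Matrix.toLin' Jᵀ).toContinuousLinearMap)) (fun i => g i s) := by
      intro g
      obtain ⟨a, b, -, -, hs⟩ := exists_Icc_of_test g
      refine Continuous.integrable_of_hasCompactSupport ?_
        (HasCompactSupport.intro (isCompact_Icc (a := a) (b := b)) fun s hs' => ?_)
      · exact ((contDiff_exp_smul (-(Matrix.toLin' Jᵀ).toContinuousLinearMap)).clm_apply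
          (contDiff_pi.2 fun i => (g i).contDiff)).continuous
      · rw [show (fun i => g i s) = 0 from funext fun i => hs s hs' i, map_zero]
    rw [← integral_add (hint g) (hint g')]
    congr 1
    ext1 s
    rw [← map_add]
    rfl
  map_smul' c g := by
    rw [RingHom.id_apply, ← integral_smul]
    congr 1
    ext1 s
    rw [← map_smul]
    rfl

lemma mem_range_pencilOp_of_odeObstruction {d : ℕ} (J : Matrix (Fin d) (Fin d) ℝ)
    (g : Fin d → Test) (hg : odeObstruction J g = 0) :
    ∃ Ψ, pencilOp testDeriv 1 J Ψ = g := by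
  obtain ⟨a, b, ha, -, hs⟩ := exists_Icc_of_test g
  have hsm : ContDiff ℝ (⊤ : ℕ∞) (fun s i => g i s) := contDiff_pi.2 fun i => (g i).contDiff
  obtain ⟨y, hy, hy0, hyeq⟩ := exists_compactSupport_solution
    (Matrix.toLin' Jᵀ).toContinuousLinearMap hsm ha
    (fun s hs' => funext fun i => hs s hs' i) hg
  have hts : ∀ i, tsupport (fun t => y t i) ⊆ Set.Icc a b := fun i =>
    closure_minimal (fun s hs' => by
      by_contra hcon
      exact hs' (by simp [hy0 s hcon])) isClosed_Icc
  refine ⟨fun i => ⟨fun t => y t i, contDiff_pi.1 hy i,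
    isCompact_Icc.of_isClosed_subset (isClosed_tsupport _) (hts i),
    (hts i).trans fun s hs' => lt_of_lt_of_le ha hs'.1⟩, ?_⟩
  ext j t
  have hd : ∀ i, deriv (fun s => y s i) t = deriv y t i := fun i =>
    (hasDerivAt_pi.1 ((hy.differentiable (by simp)).differentiableAt (x := t)).hasDerivAt i).deriv
  have h := congrFun (hyeq t) j
  rw [pencilOp_apply]
  change (∑ i, J i j • _ : Test) t - (∑ i, _ : Test) t = _
  rw [sum_smul_test_apply, sum_smul_test_apply, ← h]
  simp only [testDeriv_apply, Matrix.one_apply, ite_mul, one_mul, zero_mul,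
    Finset.sum_ite_eq', Finset.mem_univ, if_true]
  change ∑ i, J i j * y t i - deriv (fun s => y s j) t = _
  rw [hd]
  simp [Matrix.toLin'_apply, Matrix.mulVec, dotProduct]

/-- The Kronecker form decouples the adjoint equation. Only the `J` block is obstructed, so the
range has codimension at most `d`. -/
lemma KroneckerForm.exists_obstruction {n : ℕ} {A B : Matrix (Fin n) (Fin n) ℝ}
    (K : KroneckerForm A B) : ∃ ρ : (Fin n → Test) →ₗ[ℝ] (Fin K.d → ℝ),
      LinearMap.ker ρ ≤ LinearMap.range (pencilOp testDeriv A B) := by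
  set e : Fin K.d ⊕ Fin K.q ≃ Fin n := finSumFinEquiv.trans (finCongr K.dim_eq) with he
  refine ⟨odeObstruction K.J ∘ₗ LinearMap.funLeft ℝ Test (fun i => e (Sum.inl i)) ∘ₗ rowMul K.Q,
    fun G hG => ?_⟩
  obtain ⟨Ψ, hΨ⟩ := mem_range_pencilOp_of_odeObstruction K.J _ hG
  obtain ⟨χ, hχ⟩ := pencilOp_nilpotent_surjective testDeriv K.isNilpotent_N
    (fun i => rowMul K.Q G (e (Sum.inr i)))
  refine ⟨rowMul K.P fun k => Sum.elim Ψ χ (e.symm k), ?_⟩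
  apply rowMul_injective_of_isUnit K.isUnit_Q
  rw [← pencilOp_mul_mul, K.PAQ_eq, K.PBQ_eq, ← he]
  ext1 k
  obtain ⟨k, rfl⟩ := e.surjective k
  rw [pencilOp_apply, ← e.sum_comp, ← e.sum_comp]
  simp only [Matrix.reindex_apply, Matrix.submatrix_apply, Equiv.symm_apply_apply,
    Fintype.sum_sum_type, Sum.elim_inl, Sum.elim_inr]
  rcases k with k | k
  · have := congrFun hΨ k
    simpa [pencilOp_apply] using this
  · have := congrFun hχ k
    simpa [pencilOp_apply] using this

/-! ### Nondegenerate Gaussian vectors. -/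

lemma absolutelyContinuous_pi {n : ℕ} (ν : Fin n → Measure ℝ) [∀ i, SigmaFinite (ν i)]
    (h : ∀ i, ν i ≪ volume) : Measure.pi ν ≪ (volume : Measure (Fin n → ℝ)) := by
  induction n with
  | zero =>
    rw [volume_pi, Subsingleton.elim ν fun _ => volume]
  | succ n ih =>
    have h1 := (measurePreserving_piFinSuccAbove ν 0).symm
    have h2 := (measurePreserving_piFinSuccAbove (fun _ : Fin (n + 1) => (volume : Measure ℝ)) 0).symm
    rw [volume_pi, ← h1.map_eq, ← h2.map_eq]
    refine Measure.AbsolutelyContinuous.map (Measure.AbsolutelyContinuous.prod (h 0) ?_)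
      (MeasurableEquiv.measurable _)
    exact ih _ fun i => h _

section Gaussian

variable {Ω : Type*} [MeasurableSpace Ω] {μ : Measure Ω} [IsProbabilityMeasure μ]

/-- In a basis orthogonal for the covariance form the coordinates are uncorrelated and jointly
Gaussian, hence independent. The law is then a product of nondegenerate Gaussians, carried back by
an invertible matrix. -/
lemma absolutelyContinuous_of_hasGaussianLaw {n : ℕ} {X : Fin n → Ω → ℝ}
    (hX : HasGaussianLaw (fun ω i => X i ω) μ)
    (hvar : ∀ w : Fin n → ℝ, w ≠ 0 → Var[fun ω => ∑ i, w i * X i ω; μ] ≠ 0) :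
    μ.map (fun ω i => X i ω) ≪ (volume : Measure (Fin n → ℝ)) := by
  have hXi : ∀ i, HasGaussianLaw (X i) μ := fun i => hX.eval i
  let c : (Fin n → ℝ) → Ω → ℝ := fun w ω => ∑ i, w i * X i ω
  have hL2 : ∀ w, MemLp (c w) 2 μ := fun w =>
    memLp_finsetSum _ fun i _ => ((hXi i).memLp_two).const_mul (w i)
  have hadd : ∀ w w', c (w + w') = c w + c w' := fun w w' => by
    ext ω
    simp [c, add_mul, Finset.sum_add_distrib]
  have hsmul : ∀ (a : ℝ) w, c (a • w) = a • c w := fun a w => by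
    ext ω
    simp [c, Finset.mul_sum, mul_assoc]
  let B : LinearMap.BilinForm ℝ (Fin n → ℝ) := LinearMap.mk₂ ℝ (fun w w' => cov[c w, c w'; μ])
    (fun w w' z => by rw [hadd, covariance_add_left (hL2 _) (hL2 _) (hL2 _)])
    (fun a w z => by rw [hsmul, covariance_smul_left, smul_eq_mul])
    (fun z w w' => by rw [hadd, covariance_add_right (hL2 _) (hL2 _) (hL2 _)])
    (fun a w z => by rw [hsmul, covariance_smul_right, smul_eq_mul])
  have hB : LinearMap.IsSymm B := ⟨fun w w' => covariance_comm _ _⟩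
  have : Invertible (2 : ℝ) := invertibleOfNonzero two_ne_zero
  obtain ⟨v₀, hv₀⟩ := LinearMap.BilinForm.exists_orthogonal_basis hB
  let v : Module.Basis (Fin n) ℝ (Fin n → ℝ) := v₀.reindex (finCongr (by simp))
  have hv : ∀ i j, i ≠ j → cov[c (v i), c (v j); μ] = 0 := by
    intro i j hij
    simp only [v, Module.Basis.reindex_apply]
    exact hv₀ fun h => hij ((finCongr _).symm.injective h)
  let M : Matrix (Fin n) (Fin n) ℝ := Matrix.of fun i k => v i k
  have hM : IsUnit M := Matrix.linearIndependent_rows_iff_isUnit.1 v.linearIndependent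
  have hdet : IsUnit M.det := (Matrix.isUnit_iff_isUnit_det M).1 hM
  have hY : HasGaussianLaw (fun ω i => c (v i) ω) μ := by
    have := hX.map_fun (Matrix.toLin' M).toContinuousLinearMap
    exact this
  have hindep : iIndepFun (fun i => c (v i)) μ := hY.iIndepFun_of_covariance_eq_zero hv
  have hYi : ∀ i, HasGaussianLaw (c (v i)) μ := fun i => hY.eval i
  have hYac : μ.map (fun ω i => c (v i) ω) ≪ (volume : Measure (Fin n → ℝ)) := by
    have hlaw : ∀ i, μ.map (c (v i)) ≪ (volume : Measure ℝ) := fun i => by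
      rw [(hYi i).map_eq_gaussianReal]
      refine gaussianReal_absolutelyContinuous _ fun h0 => hvar (v i) (v.ne_zero i) ?_
      exact le_antisymm (Real.toNNReal_eq_zero.1 h0) (variance_nonneg _ _)
    have (i : Fin n) : IsProbabilityMeasure (μ.map (c (v i))) :=
      Measure.isProbabilityMeasure_map (hYi i).aemeasurable
    rw [(iIndepFun_iff_map_fun_eq_pi_map fun i => (hYi i).aemeasurable).1 hindep]
    exact absolutelyContinuous_pi _ hlaw
  have hXY : (fun ω i => X i ω) = Matrix.toLin' M⁻¹ ∘ fun ω i => c (v i) ω := by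
    ext1 ω
    have : (fun i => c (v i) ω) = M *ᵥ fun i => X i ω := rfl
    rw [Function.comp_apply, this, Matrix.toLin'_apply, Matrix.mulVec_mulVec,
      Matrix.nonsing_inv_mul _ hdet, Matrix.one_mulVec]
  have hmeas : Measurable (Matrix.toLin' M⁻¹) :=
    (Matrix.toLin' M⁻¹).continuous_of_finiteDimensional.measurable
  rw [hXY, ← AEMeasurable.map_map_of_aemeasurable hmeas.aemeasurable hY.aemeasurable]
  refine (hYac.map hmeas).trans ?_
  rw [Real.map_matrix_volume_pi_eq_smul_volume_pi
    (Matrix.isUnit_nonsing_inv_det M hdet).ne_zero]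
  exact Measure.smul_absolutelyContinuous

end Gaussian

/-! ### Pairings with white noise. -/

lemma Distr.measurable_apply (φ : Test) : Measurable fun T : Distr => T φ := by
  refine measurable_of_isOpen fun s hs => MeasurableSpace.measurableSet_generateFrom ?_
  exact ⟨(fun F : Test → ℝ => F φ) ⁻¹' s, hs.preimage (continuous_apply φ), rfl⟩

lemma test_eq_zero_of_integral_mul_self {φ : Test}
    (h : ∫ s in Set.Ioi (0 : ℝ), φ s * φ s = 0) : φ = 0 := by
  rw [setIntegral_eq_integral_of_forall_compl_eq_zero] at h
  · ext s
    by_contra hs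
    refine absurd h (Continuous.integral_pos_of_hasCompactSupport_nonneg_nonzero (x := s)
      (φ.continuous.mul φ.continuous) φ.hasCompactSupport.mul_left
      (fun t => mul_self_nonneg (φ t)) (mul_self_ne_zero.2 hs)).ne'
  · intro s hs
    have : φ s = 0 := image_eq_zero_of_notMem_tsupport fun hs' => hs (φ.tsupport_subset hs')
    simp [this]

/-- The pairing `∑ ⟨T_j, Θ_j⟩` of a vector of distributions and a vector of test functions. -/
noncomputable def pairing {ι : Type*} [Fintype ι] (T : ι → Distr) : (ι → Test) →ₗ[ℝ] ℝ where
  toFun Θ := ∑ j, T j (Θ j)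
  map_add' Θ Θ' := by simp [Finset.sum_add_distrib]
  map_smul' c Θ := by simp [Finset.mul_sum]

lemma pairing_apply {ι : Type*} [Fintype ι] (T : ι → Distr) (Θ : ι → Test) :
    pairing T Θ = ∑ j, T j (Θ j) := rfl

section WhiteNoise

variable {Ω : Type*} [MeasurableSpace Ω] {μ : Measure Ω}

lemma IsWhiteNoise.hasGaussianLaw {ξ : Ω → Distr} (hξ : IsWhiteNoise μ ξ) (φ : Test) :
    HasGaussianLaw (fun ω => ξ ω φ) μ := by
  obtain ⟨v, hv⟩ := hξ.gaussian φ
  exact ⟨by rw [hv]; infer_instance⟩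

lemma IsWhiteNoise.variance {ξ : Ω → Distr} (hξ : IsWhiteNoise μ ξ) (φ : Test) :
    Var[fun ω => ξ ω φ; μ] = ∫ s in Set.Ioi (0 : ℝ), φ s * φ s := by
  obtain ⟨v, hv⟩ := hξ.gaussian φ
  have hm : AEMeasurable (fun ω => ξ ω φ) μ := (hξ.hasGaussianLaw φ).aemeasurable
  have h0 : ∫ ω, ξ ω φ ∂μ = 0 := by
    have := integral_map (f := id) hm measurable_id.aestronglyMeasurable
    rw [hv] at this
    simpa using this.symm
  rw [variance_of_integral_eq_zero hm h0, ← hξ.correlation]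
  simp_rw [sq]

variable {m : ℕ} {ξ : Ω → Fin m → Distr}

lemma IsWhiteNoiseVec.iIndepFun_apply (hξ : IsWhiteNoiseVec μ ξ) (η : Fin m → Test) :
    iIndepFun (fun l ω => ξ ω l (η l)) μ :=
  hξ.indep.comp (fun l T => T (η l)) fun l => Distr.measurable_apply (η l)

lemma IsWhiteNoiseVec.hasGaussianLaw_pairing (hξ : IsWhiteNoiseVec μ ξ) (η : Fin m → Test) :
    HasGaussianLaw (fun ω => pairing (ξ ω) η) μ :=
  iIndepFun.hasGaussianLaw_fun_sum (fun l => (hξ.component l).hasGaussianLaw (η l))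
    (hξ.iIndepFun_apply η)

lemma IsWhiteNoiseVec.variance_pairing (hξ : IsWhiteNoiseVec μ ξ) (η : Fin m → Test) :
    Var[fun ω => pairing (ξ ω) η; μ] = ∑ l, ∫ s in Set.Ioi (0 : ℝ), η l s * η l s := by
  rw [← Finset.sum_congr rfl fun l _ => (hξ.component l).variance (η l)]
  rw [← IndepFun.variance_sum (fun l _ => ((hξ.component l).hasGaussianLaw (η l)).memLp_two)
    fun i _ j _ hij => (hξ.iIndepFun_apply η).indepFun hij]
  congr 1
  ext ω
  simp [pairing_apply]

lemma IsWhiteNoiseVec.eq_zero_of_variance_pairing (hξ : IsWhiteNoiseVec μ ξ) {η : Fin m → Test}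
    (h : Var[fun ω => pairing (ξ ω) η; μ] = 0) : η = 0 := by
  rw [hξ.variance_pairing, Finset.sum_eq_zero_iff_of_nonneg fun l _ =>
    integral_nonneg fun s => mul_self_nonneg _] at h
  ext1 l
  exact test_eq_zero_of_integral_mul_self (h l (Finset.mem_univ l))

/-- Finitely many linearly independent integrands give a nondegenerate Gaussian vector. -/
lemma IsWhiteNoiseVec.absolutelyContinuous_pairing [IsProbabilityMeasure μ]
    (hξ : IsWhiteNoiseVec μ ξ) {n : ℕ} (η : Fin n → Fin m → Test) (hη : LinearIndependent ℝ η) :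
    μ.map (fun ω i => pairing (ξ ω) (η i)) ≪ (volume : Measure (Fin n → ℝ)) := by
  have hlin : ∀ (w : Fin n → ℝ) ω,
      ∑ i, w i * pairing (ξ ω) (η i) = pairing (ξ ω) (∑ i, w i • η i) := fun w ω => by
    simp [map_sum]
  have hm : AEMeasurable (fun ω i => pairing (ξ ω) (η i)) μ :=
    aemeasurable_pi_lambda _ fun i => (hξ.hasGaussianLaw_pairing (η i)).aemeasurable
  refine absolutelyContinuous_of_hasGaussianLaw (X := fun i ω => pairing (ξ ω) (η i)) ⟨?_⟩
    fun w hw h => hw ?_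
  -- A linear functional of these pairings is again one pairing, with coefficients `L(e_i)`.
  · refine isGaussian_of_isGaussian_map fun L => ?_
    rw [AEMeasurable.map_map_of_aemeasurable (by fun_prop) hm]
    have hL : L ∘ (fun ω i => pairing (ξ ω) (η i)) =
        fun ω => pairing (ξ ω) (∑ i, L (Pi.single i 1) • η i) := by
      ext ω
      rw [← hlin]
      have := LinearMap.pi_apply_eq_sum_univ L.toLinearMap fun i => pairing (ξ ω) (η i)
      simp only [smul_eq_mul, ContinuousLinearMap.coe_coe] at this
      rw [Function.comp_apply, this]
      refine Finset.sum_congr rfl fun i _ => ?_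
      rw [mul_comm]
      congr 2
      ext j
      simp [Pi.single_apply, eq_comm]
    rw [hL]
    exact (hξ.hasGaussianLaw_pairing _).isGaussian_map
  · simp_rw [hlin] at h
    exact funext (Fintype.linearIndependent_iff.1 hη w (hξ.eq_zero_of_variance_pairing h))

end WhiteNoise

/-! ### From the equation and the initial condition to the noise. -/

lemma SolvesDAE.pairing_pencilOp {n : ℕ} {A B : Matrix (Fin n) (Fin n) ℝ} {g x : Fin n → Distr}
    (h : SolvesDAE A B g x) (Θ : Fin n → Test) :
    pairing x (pencilOp testDeriv A B Θ) = pairing g Θ := by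
  have hi : ∀ i, g i (Θ i) = ∑ j, (B i j * x j (Θ i) - A i j * x j (testDeriv (Θ i))) := fun i => by
    have := congrFun (h (Θ i)) i
    simp only [Distr.lineDeriv_apply, Pi.add_apply, Matrix.mulVec, dotProduct] at this
    rw [← this, ← Finset.sum_add_distrib]
    exact Finset.sum_congr rfl fun j _ => by ring
  simp_rw [pairing_apply, hi, pencilOp_apply]
  rw [Finset.sum_comm]
  simp [Finset.sum_sub_distrib, map_sum]

lemma pairing_add_sum_smul {n m : ℕ} (f : Fin n → Distr) (Λ : Matrix (Fin n) (Fin m) ℝ)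
    (ξ : Fin m → Distr) (Θ : Fin n → Test) :
    pairing (fun i => f i + ∑ l, Λ i l • ξ l) Θ = pairing f Θ + pairing ξ (rowMul Λ Θ) := by
  have h : ∀ i, (f i + ∑ l, Λ i l • ξ l : Distr) (Θ i) = f i (Θ i) + ∑ l, Λ i l * ξ l (Θ i) := by
    intro i
    let ev : Distr →ₗ[ℝ] ℝ := ⟨⟨fun T => T (Θ i), fun _ _ => rfl⟩, fun _ _ => rfl⟩
    change ev (f i + ∑ l, Λ i l • ξ l) = _
    rw [map_add, map_sum]
    rfl
  simp only [pairing_apply, h, rowMul_apply, Finset.sum_add_distrib, map_sum, map_smul,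
    smul_eq_mul]
  rw [Finset.sum_comm]

/-- The rows of `Λ` are independent, and the claim is pointwise in `s`. This ensures that no
combination of the equations is free of noise. -/
lemma rowMul_injective_of_rank {n m : ℕ} {Λ : Matrix (Fin n) (Fin m) ℝ} (hΛ : Λ.rank = n) :
    Function.Injective (rowMul Λ : (Fin n → Test) →ₗ[ℝ] (Fin m → Test)) := by
  have hli : LinearIndependent ℝ Λ.row := by
    rw [linearIndependent_iff_card_eq_finrank_span, Fintype.card_fin]
    exact hΛ.symm.trans Λ.rank_eq_finrank_span_row
  rw [← LinearMap.ker_eq_bot, LinearMap.ker_eq_bot']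
  intro Θ hΘ
  ext i s
  have h : (fun i => Θ i s) ᵥ* Λ = 0 ᵥ* Λ := by
    ext l
    have h' := DFunLike.congr_fun (congrFun hΘ l) s
    rw [rowMul_apply, sum_smul_test_apply] at h'
    rw [Matrix.zero_vecMul]
    simpa [Matrix.vecMul, dotProduct, mul_comm] using h'
  exact congrFun (Matrix.vecMul_injective_iff.2 hli h) i

/-- The vector of test functions `φ₀ β Q₁`, where `Q₁` consists of the first `d` rows of `Q⁻¹`. -/
noncomputable def KroneckerForm.initialRow {n : ℕ} {A B : Matrix (Fin n) (Fin n) ℝ}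
    (K : KroneckerForm A B) (φ₀ : Test) : (Fin K.d → ℝ) →ₗ[ℝ] (Fin n → Test) where
  toFun β j := (∑ i, β i * K.Q⁻¹ (finCongr K.dim_eq (Fin.castAdd K.q i)) j) • φ₀
  map_add' β β' := by
    ext1 j
    simp [add_mul, Finset.sum_add_distrib, add_smul]
  map_smul' c β := by
    ext1 j
    simp [Finset.mul_sum, mul_assoc, smul_smul]

section

variable {n : ℕ} {A B : Matrix (Fin n) (Fin n) ℝ} (K : KroneckerForm A B)

lemma KroneckerForm.initialRow_apply (φ₀ : Test) (β : Fin K.d → ℝ) (j : Fin n) :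
    K.initialRow φ₀ β j =
      (∑ i, β i * K.Q⁻¹ (finCongr K.dim_eq (Fin.castAdd K.q i)) j) • φ₀ := rfl

lemma KroneckerForm.InitialCondition.pairing_initialRow {K : KroneckerForm A B} {φ₀ : Test}
    {u₀ : Fin K.d → ℝ} {x : Fin n → Distr} (h : K.InitialCondition φ₀ u₀ x) (β : Fin K.d → ℝ) :
    pairing x (K.initialRow φ₀ β) = ∑ i, β i * u₀ i := by
  simp_rw [← h _, pairing_apply, K.initialRow_apply, map_smul, smul_eq_mul, Finset.sum_mul,
    Matrix.mulVec, dotProduct, Finset.mul_sum, mul_assoc]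
  rw [Finset.sum_comm]

lemma KroneckerForm.initialRow_injective {φ₀ : Test} (hφ₀ : φ₀ ≠ 0) :
    Function.Injective (K.initialRow φ₀) := by
  rw [← LinearMap.ker_eq_bot, LinearMap.ker_eq_bot']
  intro β hβ
  have hQ : IsUnit K.Q⁻¹ := Matrix.isUnit_nonsing_inv_iff.2 K.isUnit_Q
  have hli := (Matrix.linearIndependent_rows_iff_isUnit.2 hQ).comp
    (fun i : Fin K.d => finCongr K.dim_eq (Fin.castAdd K.q i))
    ((finCongr K.dim_eq).injective.comp (Fin.castAdd_injective _ _))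
  refine funext (Fintype.linearIndependent_iff.1 hli β ?_)
  ext j
  have := congrFun hβ j
  rw [K.initialRow_apply] at this
  rw [Finset.sum_apply]
  exact (smul_eq_zero.1 this).resolve_right hφ₀

end

variable {Ω : Type*} [MeasurableSpace Ω] {μ : Measure Ω}

lemma IsSolution.ae_pairing_pencilOp {n m : ℕ} {A B : Matrix (Fin n) (Fin n) ℝ}
    {f : Fin n → Distr} {Λ : Matrix (Fin n) (Fin m) ℝ} {ξ : Ω → Fin m → Distr}
    {x : Ω → Fin n → Distr} (hx : IsSolution μ A B f Λ ξ x) (Θ : Fin n → Test) :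
    ∀ᵐ ω ∂μ, pairing (x ω) (pencilOp testDeriv A B Θ) =
      pairing f Θ + pairing (ξ ω) (rowMul Λ Θ) := by
  filter_upwards [hx.solves] with ω hω
  rw [hω.pairing_pencilOp, pairing_add_sum_smul]

lemma eq_zero_of_smul_eq_initialRow {n : ℕ} {A B : Matrix (Fin n) (Fin n) ℝ}
    (K : KroneckerForm A B) {φ₀ φ : Test} (hφ : φ ≠ 0)
    (hφφ₀ : 0 < K.d → ∀ c : ℝ, φ ≠ c • φ₀) {w : Fin n → ℝ} {β : Fin K.d → ℝ}
    (h : ∀ j, w j • φ = K.initialRow φ₀ β j) : w = 0 := by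
  ext j
  by_contra hj
  have hφeq : φ = ((w j)⁻¹ * ∑ i, β i * K.Q⁻¹ (finCongr K.dim_eq (Fin.castAdd K.q i)) j) • φ₀ := by
    rw [mul_smul, ← K.initialRow_apply φ₀ β j, ← h j, smul_smul, inv_mul_cancel₀ hj, one_smul]
  -- When `d = 0` the coefficient of `φ₀` is an empty sum, so `φ = 0`.
  rcases Nat.eq_zero_or_pos K.d with hd | hd
  · have : IsEmpty (Fin K.d) := by rw [hd]; infer_instance
    exact hφ (by simpa using hφeq)
  · exact hφφ₀ hd _ hφeq

end SDAE

theorem corollary4p5 {Ω : Type*} [MeasurableSpace Ω] (μ : Measure Ω) [IsProbabilityMeasure μ]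
    {n m : ℕ} (A B : Matrix (Fin n) (Fin n) ℝ) (f : Fin n → SDAE.Distr)
    (Λ : Matrix (Fin n) (Fin m) ℝ) (ξ : Ω → Fin m → SDAE.Distr)
    (hξ : SDAE.IsWhiteNoiseVec μ ξ)
    (hAB : SDAE.IsRegularPencil A B) (hΛ : Λ.rank = n)
    (K : SDAE.KroneckerForm A B) (hindex : K.index ≤ 4)
    (φ₀ : SDAE.Test) (hφ₀ : ∫ t in Set.Ioi (0 : ℝ), φ₀ t = 1) (u₀ : Fin K.d → ℝ)
    (x : Ω → Fin n → SDAE.Distr) (hx : SDAE.IsSolution μ A B f Λ ξ x)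
    (hinit : ∀ᵐ ω ∂μ, K.InitialCondition φ₀ u₀ (x ω))
    (φ : SDAE.Test) (hφ : φ ≠ 0) (hφφ₀ : 0 < K.d → ∀ c : ℝ, φ ≠ c • φ₀) :
    μ.map (fun ω i => x ω i φ) ≪ (volume : Measure (Fin n → ℝ)) := by
  open SDAE in
  have hφ₀ne : φ₀ ≠ 0 := by
    rintro rfl
    simp at hφ₀
  have hΛinj := rowMul_injective_of_rank hΛ
  obtain ⟨ρ, hρ⟩ := K.exists_obstruction
  rcases exists_mem_range_or_forall_sub_mem_range _ ρ hρ (K.initialRow φ₀) with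
    ⟨β, hβ, Θ, hΘ⟩ | hsurj
  · -- an initial condition which the noise makes random cannot be met
    refine absurd ?_ hβ
    have hconst : (fun ω => pairing (ξ ω) (rowMul Λ Θ)) =ᵐ[μ]
        fun _ => ∑ i, β i * u₀ i - pairing f Θ := by
      filter_upwards [hx.ae_pairing_pencilOp Θ, hinit] with ω h1 h2
      rw [hΘ, h2.pairing_initialRow] at h1
      rw [h1, add_sub_cancel_left]
    have hvar : Var[fun ω => pairing (ξ ω) (rowMul Λ Θ); μ] = 0 := by
      rw [variance_congr hconst]
      simp [variance_eq_integral]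
    -- The variance is the squared `L²` norm of `Θ Λ`, so it vanishes only for `Θ Λ = 0`.
    have hΘ0 : Θ = 0 := hΛinj ((hξ.eq_zero_of_variance_pairing hvar).trans (map_zero _).symm)
    rw [hΘ0, map_zero] at hΘ
    exact K.initialRow_injective hφ₀ne (hΘ.symm.trans (map_zero _).symm)
  -- `Pi.single i φ` is the row whose pairing with `x` is `⟨x_i, φ⟩`.
  · choose β Θ hΘ using fun i : Fin n => hsurj (Pi.single i φ)
    have hli : LinearIndependent ℝ fun i => rowMul Λ (Θ i) := by
      refine Fintype.linearIndependent_iff.2 fun w hw => congrFun ?_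
      have hw' : ∑ i, w i • Θ i = 0 := hΛinj (by simpa [map_sum] using hw)
      -- Applying the adjoint operator to `∑ w_i Θ_i = 0` gives `w φ = φ₀ (∑ w_i β_i) Q₁`.
      refine eq_zero_of_smul_eq_initialRow K hφ hφφ₀ (β := ∑ i, w i • β i) fun j => ?_
      have h := congrArg (pencilOp testDeriv A B) hw'
      simp only [map_sum, map_smul, hΘ, map_zero, smul_sub, Finset.sum_sub_distrib] at h
      have h' := congrFun (sub_eq_zero.1 h) j
      rw [map_sum, Finset.sum_congr rfl fun i _ => map_smul (K.initialRow φ₀) (w i) (β i), ← h']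
      simp [Finset.sum_apply, Pi.single_apply]
    have hac := hξ.absolutelyContinuous_pairing _ hli
    -- The deterministic part: forcing plus initial data. A translation preserves Lebesgue null
    -- sets.
    let c : Fin n → ℝ := fun i => pairing f (Θ i) + ∑ k, β i k * u₀ k
    have hxeq : (fun ω i => x ω i φ) =ᵐ[μ]
        (fun z => c + z) ∘ fun ω i => pairing (ξ ω) (rowMul Λ (Θ i)) := by
      filter_upwards [ae_all_iff.2 fun i => hx.ae_pairing_pencilOp (Θ i), hinit] with ω h1 h2
      ext i
      have h := h1 i
      rw [hΘ, map_sub, h2.pairing_initialRow] at h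
      have hs : pairing (x ω) (Pi.single i φ) = x ω i φ := by
        rw [pairing_apply, Finset.sum_eq_single i]
        · simp
        · intro j _ hj
          simp [Pi.single_eq_of_ne hj]
        · simp
      rw [hs] at h
      simp only [Function.comp_apply, Pi.add_apply, c]
      linarith
    have hm : AEMeasurable (fun ω i => pairing (ξ ω) (rowMul Λ (Θ i))) μ :=
      aemeasurable_pi_lambda _ fun i => (hξ.hasGaussianLaw_pairing _).aemeasurable
    rw [Measure.map_congr hxeq,
      ← AEMeasurable.map_map_of_aemeasurable (measurable_const_add c).aemeasurable hm]
    refine (hac.map (measurable_const_add c)).trans ?_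
    rw [map_add_left_eq_self]
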